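/- Let $d\ge 1$, $\sigma>0$, let $\Omega\subset\mathbb{R}^d$ be bounded, and let $\mathcal H$ be the reproducing kernel Hilbert space of real functions on $\mathbb{R}^d$ with the Gaussian kernel $K(x,z)=\exp\left(-\frac{\|x-z\|^2}{2\sigma^2}\right)$. Let $P$ be a probability measure on $\Omega\times\{-1,1\}$, with $x$-marginal $P_X$, whose Bayes risk $\inf_c P(c(x)\ne y)$ (infimum over measurable classifiers $c$ with values in $\{-1,1\}$) is non-zero. For $t>0$ and a portion $\beta\in(0,1]$, say that a function $h$ $t$-overfits the labelled sample $(x_i,y_i)$, $i=1,\dots,n$, if $y_ih(x_i)>0$ for all $i$ (zero classification loss) and $y_ih(x_i)>t$ for at least $\beta n$ of the indices $i$. Let the portion $\beta$ be such that $P_X(S)<\beta$ for every measurable set $S\subset\mathbb{R}^d$ on which $y$ is $P$-almost surely a deterministic (measurable) function of $x$. (For $\beta=1$ this is exactly the non-zero Bayes risk assumption; every $\beta\in(0,1]$ is allowed if $y$ is not a deterministic function of $x$ on any set of positive measure.) Then for every $t>0$ there are constants $A,B>0$ (which may depend on $t$, $\beta$, $d$, $\sigma$, $\Omega$ and $P$,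 but not on $n$) such that, for $(x_i,y_i)$, $i=1,\dots,n$, drawn independently from $P$, with probability tending to $1$ as $n\to\infty$ every $h\in\mathcal H$ that $t$-overfits the data satisfies $$\|h\|_{\mathcal H}>A\,e^{B\,n^{1/d}}.$$ -/

import Mathlib

open MeasureTheory ProbabilityTheory Filter Topology

noncomputable section

/-- The Gaussian kernel `K(x, z) = exp (-‖x - z‖² / (2 σ²))` on `ℝᵈ`; a real number is viewed as
the scalar operator `ℝ →L[ℝ] ℝ`, as Mathlib's (vector-valued) kernels require. -/
def gaussianKernel (d : ℕ) (σ : ℝ) :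
    Matrix (EuclideanSpace ℝ (Fin d)) (EuclideanSpace ℝ (Fin d)) (ℝ →L[ℝ] ℝ) :=
  Matrix.of fun x z =>
    Real.exp (-‖x - z‖ ^ 2 / (2 * σ ^ 2)) • ContinuousLinearMap.id ℝ ℝ

/-- A Gaussian function is an average of cosines. -/
theorem exp_neg_sq_eq_integral_cos {d : ℕ} (t : EuclideanSpace ℝ (Fin d)) :
    Real.exp (-‖t‖ ^ 2 / 2) =
      ∫ u, Real.cos (inner ℝ u t) ∂(stdGaussian (EuclideanSpace ℝ (Fin d))) := by
  have h := charFun_stdGaussian (E := EuclideanSpace ℝ (Fin d)) t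
  rw [charFun_apply] at h
  have hint : Integrable (fun u : EuclideanSpace ℝ (Fin d) =>
      Complex.exp (((inner ℝ u t : ℝ) : ℂ) * Complex.I))
      (stdGaussian (EuclideanSpace ℝ (Fin d))) := by
    refine Integrable.of_bound (C := 1) (by fun_prop) (ae_of_all _ fun u => ?_)
    rw [Complex.norm_exp_ofReal_mul_I]
  have h2 := congrArg Complex.re h
  have h3 := integral_re hint
  simp only [RCLike.re_eq_complex_re, Complex.exp_ofReal_mul_I_re] at h3
  rw [h3, h2, ← Complex.ofReal_pow, ← Complex.ofReal_neg]
  norm_cast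

/-- The Gaussian kernel is positive semidefinite. -/
theorem gaussianKernel_posSemidef (d : ℕ) (σ : ℝ) : (gaussianKernel d σ).PosSemidef := by
  have htfae := (RKHS.posSemidef_tfae (K := gaussianKernel d σ)).out 0 2
  refine htfae.mpr ⟨?_, fun vv => ?_⟩
  · have hid : star (ContinuousLinearMap.id ℝ ℝ) = ContinuousLinearMap.id ℝ ℝ :=
      star_one (ℝ →L[ℝ] ℝ)
    ext x z
    simp [gaussianKernel, Matrix.conjTranspose_apply, norm_sub_rev x z, hid]
  · have key : ∀ x z : EuclideanSpace ℝ (Fin d),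
        Real.exp (-‖x - z‖ ^ 2 / (2 * σ ^ 2)) =
          ∫ u, (Real.cos (inner ℝ u (σ⁻¹ • x)) * Real.cos (inner ℝ u (σ⁻¹ • z))
            + Real.sin (inner ℝ u (σ⁻¹ • x)) * Real.sin (inner ℝ u (σ⁻¹ • z)))
            ∂(stdGaussian (EuclideanSpace ℝ (Fin d))) := by
      intro x z
      have h1 : -‖x - z‖ ^ 2 / (2 * σ ^ 2) = -‖σ⁻¹ • x - σ⁻¹ • z‖ ^ 2 / 2 := by
        rw [← smul_sub, norm_smul, mul_pow, Real.norm_eq_abs, sq_abs, inv_pow, mul_comm 2,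
          ← div_div]
        ring
      rw [h1, exp_neg_sq_eq_integral_cos]
      refine integral_congr_ae (ae_of_all _ fun u => ?_)
      simp only [inner_sub_right, Real.cos_sub]
    have hint : ∀ x z : EuclideanSpace ℝ (Fin d), ∀ c : ℝ,
        Integrable (fun u => c * (Real.cos (inner ℝ u (σ⁻¹ • x)) * Real.cos (inner ℝ u (σ⁻¹ • z))
            + Real.sin (inner ℝ u (σ⁻¹ • x)) * Real.sin (inner ℝ u (σ⁻¹ • z))))
            (stdGaussian (EuclideanSpace ℝ (Fin d))) := by
      intro x z c
      refine Integrable.const_mul ?_ c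
      refine Integrable.of_bound (C := 1) (by fun_prop) (ae_of_all _ fun u => ?_)
      rw [← Real.cos_sub, Real.norm_eq_abs]
      exact Real.abs_cos_le_one _
    have hsum : (vv.sum fun x w => vv.sum fun x' w' => inner ℝ ((gaussianKernel d σ x' x) w) w') =
        ∫ u, ((∑ x ∈ vv.support, vv x * Real.cos (inner ℝ u (σ⁻¹ • x))) ^ 2
          + (∑ x ∈ vv.support, vv x * Real.sin (inner ℝ u (σ⁻¹ • x))) ^ 2)
            ∂(stdGaussian (EuclideanSpace ℝ (Fin d))) := by
      have hterm : ∀ x x' : EuclideanSpace ℝ (Fin d),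
          inner ℝ ((gaussianKernel d σ x' x) (vv x)) (vv x') =
          ∫ u, (vv x * vv x') * (Real.cos (inner ℝ u (σ⁻¹ • x')) * Real.cos (inner ℝ u (σ⁻¹ • x))
            + Real.sin (inner ℝ u (σ⁻¹ • x')) * Real.sin (inner ℝ u (σ⁻¹ • x)))
            ∂(stdGaussian (EuclideanSpace ℝ (Fin d))) := by
        intro x x'
        rw [integral_const_mul, ← key x' x]
        simp [gaussianKernel]
        ring
      simp only [Finsupp.sum, hterm]
      rw [Finset.sum_congr rfl fun x _ =>
          (integral_finsetSum vv.support fun x' _ => hint x' x (vv x * vv x')).symm,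
        ← integral_finsetSum _ fun x _ => integrable_finsetSum _ fun x' _ => hint x' x _]
      refine integral_congr_ae (ae_of_all _ fun u => ?_)
      simp only [sq, Finset.sum_mul_sum, ← Finset.sum_add_distrib]
      refine Finset.sum_congr rfl fun x _ => Finset.sum_congr rfl fun x' _ => ?_
      ring
    rw [hsum]
    simp only [RCLike.re_to_real]
    exact integral_nonneg fun u => by positivity

instance gaussianKernel_fact (d : ℕ) (σ : ℝ) : Fact (gaussianKernel d σ).PosSemidef :=
  ⟨gaussianKernel_posSemidef d σ⟩

/-- The reproducing kernel Hilbert space of real functions on `ℝᵈ` with the Gaussian kernel of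
bandwidth `σ`. -/
abbrev GaussianRKHS (d : ℕ) (σ : ℝ) := RKHS.OfKernel (gaussianKernel d σ)

/-- The Bayes risk (label noise) of a distribution `P` of a labelled point `(x, y)`: the infimum of
the misclassification probability over all measurable classifiers with values in `{-1, 1}`. -/
def classBayesRisk {X : Type*} [MeasurableSpace X] (P : Measure (X × ℝ)) : ENNReal :=
  ⨅ (c : X → ℝ) (_ : Measurable c) (_ : ∀ x, c x = 1 ∨ c x = -1), P {p | c p.1 ≠ p.2}

/-- Under the law `P` of `(x, y)`, the label `y` is a deterministic function of `x` on `S`. -/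
def DeterministicOn {X : Type*} [MeasurableSpace X] (P : Measure (X × ℝ)) (S : Set X) : Prop :=
  ∃ c : X → ℝ, Measurable c ∧ ∀ᵐ p ∂P, p.1 ∈ S → p.2 = c p.1

/-- The function `f` `t`-overfits the labelled sample `s` with portion `β`: it has zero
classification loss, and the margin exceeds `t` on at least a portion `β` of the sample. -/
structure TOverfits {X : Type*} (t β : ℝ) {n : ℕ} (s : Fin n → X × ℝ) (f : X → ℝ) : Prop where
  zero_loss : ∀ i, 0 < (s i).2 * f (s i).1
  margin : β * n ≤ (Nat.card {i : Fin n // t < (s i).2 * f (s i).1} : ℝ)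

end

/-!
The proof rests on two facts: an element `h` of the Gaussian RKHS of moderate norm has few sign
patterns on `n` points, and noisy labels are unlikely to agree with any of few patterns.

*Few patterns.* Write `K (x, z) = w x * w z * exp (⟨x, z⟩ / σ²)` with `w x = exp (-‖x‖² / (2 σ²))`,
and expand the exponential. If `h` is a finite kernel expansion, then `‖h‖²` splits into nonnegative
contributions of the degrees `k`, and Cauchy–Schwarz in each degree (`sq_kernelSumPart_le`) bounds
the degree-`k` part of `h`, on a ball, by a constant times `e⁻ᵏ ‖h‖`. Hence, by density, `h` is
approximated on a ball up to `O(e⁻ᵐ ‖h‖)` by rational combinations of the constant `1` and of the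
functions `w x * x ^ α` with all exponents less than `m` (`gaussianRKHS_exists_rat_approx`). This is
a space of dimension `m ^ d + 1`. Its positivity sets have at most that Vapnik–Chervonenkis
dimension (`card_le_of_shatters_signPatterns`), so that the Sauer–Shelah lemma bounds the number of
their traces on `n` points by `exp (ε n)` as soon as `m ^ d ≤ c n` with `c` small
(`card_signPatterns_le`). With `m` of order `n ^ (1 / d)`, the approximation error is less than
`t / 4` for all `h` with `‖h‖ ≤ A * exp (B * n ^ (1 / d))`.

*Noisy labels.* If such an `h` `t`-overfits, the positivity sets of the approximants of `h - t / 2`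
and `-h - t / 2` cover at least `β n` sample points, and the labels there are `1` on the first set
and `-1` on the second (`TOverfits.labels_of_approx`). The set of points at which one of the labels
has conditional probability less than `κ` has probability less than `β` for small `κ`, since the
limiting set with `κ = 0` has deterministic labels (`exists_lowNoiseSet_lt`). So, by Hoeffding's
inequality, at least `2 δ n` of the covered points are noisy with high probability.
Conditionally on the points, a given pair of patterns predicts all these labels with probability at most `(1 - κ) ^ (2 δ n)`, and the union
bound over the `exp (2 ε n)` pairs (`pi_setOf_exists_signPatterns_le`) concludes. The rational
coefficients make the class of approximants countable, which settles all questions of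
measurability.
-/

/-! ### Approximation of the Gaussian RKHS by low-dimensional function spaces -/

theorem gaussianRKHS_abs_apply_le {d : ℕ} {σ : ℝ} (h : GaussianRKHS d σ)
    (x : EuclideanSpace ℝ (Fin d)) : |h x| ≤ ‖h‖ := by
  have h1 := RKHS.norm_apply_le h x
  rw [RKHS.OfKernel.kernel_ofKernel] at h1
  have h2 : √‖gaussianKernel d σ x x‖ ≤ 1 := by
    rw [Real.sqrt_le_iff]
    simp [gaussianKernel]
  calc |h x| = ‖h x‖ := rfl
    _ ≤ ‖h‖ * √‖gaussianKernel d σ x x‖ := h1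
    _ ≤ ‖h‖ * 1 := by gcongr
    _ = ‖h‖ := mul_one _

theorem gaussianRKHS_kerFun_apply {d : ℕ} {σ : ℝ} (x z : EuclideanSpace ℝ (Fin d)) (a : ℝ) :
    RKHS.kerFun (GaussianRKHS d σ) z a x = a * Real.exp (-‖x - z‖ ^ 2 / (2 * σ ^ 2)) := by
  rw [RKHS.kerFun_apply, RKHS.OfKernel.kernel_ofKernel]
  simp [gaussianKernel, mul_comm]

/-- Finite kernel expansions are dense in the Gaussian RKHS. -/
theorem gaussianRKHS_exists_kerFun_sum {d : ℕ} {σ : ℝ} (h : GaussianRKHS d σ) {η : ℝ}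
    (hη : 0 < η) : ∃ (N : ℕ) (z : Fin N → EuclideanSpace ℝ (Fin d)) (a : Fin N → ℝ),
      ‖h - ∑ i, RKHS.kerFun (GaussianRKHS d σ) (z i) (a i)‖ < η := by
  have hd : h ∈ Submodule.topologicalClosure (Submodule.span ℝ
      {x : GaussianRKHS d σ | ∃ z v, RKHS.kerFun (GaussianRKHS d σ) z v = x}) := by
    have := RKHS.kerFun_dense (GaussianRKHS d σ)
    rw [this]; trivial
  rw [← SetLike.mem_coe, Submodule.topologicalClosure_coe, Metric.mem_closure_iff] at hd
  obtain ⟨g, hg, hdist⟩ := hd η hη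
  obtain ⟨N, c, u, rfl⟩ := Submodule.mem_span_set'.1 hg
  choose z v hzv using fun i => (u i).2
  refine ⟨N, z, fun i => c i * v i, ?_⟩
  rw [dist_eq_norm] at hdist
  have hsum : ∑ i, RKHS.kerFun (GaussianRKHS d σ) (z i) (c i * v i) =
      ∑ i, c i • (u i : GaussianRKHS d σ) :=
    Finset.sum_congr rfl fun i _ => by rw [← hzv i, ← smul_eq_mul, map_smul]
  rw [hsum]
  exact hdist

theorem gaussianRKHS_kerFun_sum_apply {d : ℕ} {σ : ℝ} {N : ℕ}
    (z : Fin N → EuclideanSpace ℝ (Fin d)) (a : Fin N → ℝ) (x : EuclideanSpace ℝ (Fin d)) :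
    (∑ i, RKHS.kerFun (GaussianRKHS d σ) (z i) (a i)) x =
      ∑ i, a i * Real.exp (-‖x - z i‖ ^ 2 / (2 * σ ^ 2)) := by
  have := map_sum (RKHS.coeCLM (H := GaussianRKHS d σ) ℝ)
    (fun i => RKHS.kerFun (GaussianRKHS d σ) (z i) (a i)) Finset.univ
  rw [← RKHS.coeCLM_apply, this, Finset.sum_apply]
  exact Finset.sum_congr rfl fun i _ => gaussianRKHS_kerFun_apply x (z i) (a i)

theorem gaussianRKHS_norm_kerFun_sum_sq {d : ℕ} {σ : ℝ} {N : ℕ}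
    (z : Fin N → EuclideanSpace ℝ (Fin d)) (a : Fin N → ℝ) :
    ‖∑ i, RKHS.kerFun (GaussianRKHS d σ) (z i) (a i)‖ ^ 2 =
      ∑ i, ∑ j, a i * (a j * Real.exp (-‖z i - z j‖ ^ 2 / (2 * σ ^ 2))) := by
  rw [← real_inner_self_eq_norm_sq, sum_inner]
  refine Finset.sum_congr rfl fun i _ => ?_
  rw [RKHS.kerFun_inner, gaussianRKHS_kerFun_sum_apply, ← Finset.mul_sum]
  simp [mul_comm]

/-- Polarization: the Gaussian kernel is, up to the weights `exp (-‖x‖² / (2 σ²))`, the exponential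
of the inner product. -/
theorem exp_neg_norm_sub_sq {d : ℕ} (σ : ℝ) (x z : EuclideanSpace ℝ (Fin d)) :
    Real.exp (-‖x - z‖ ^ 2 / (2 * σ ^ 2)) =
      Real.exp (-‖x‖ ^ 2 / (2 * σ ^ 2)) * Real.exp (-‖z‖ ^ 2 / (2 * σ ^ 2)) *
        Real.exp (inner ℝ x z / σ ^ 2) := by
  rw [← Real.exp_add, ← Real.exp_add, norm_sub_sq_real]
  congr 1
  rcases eq_or_ne σ 0 with rfl | hσ
  · simp
  · field_simp
    ring

theorem inner_pow_eq_sum {d : ℕ} (x z : EuclideanSpace ℝ (Fin d)) (k : ℕ) :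
    (inner ℝ x z : ℝ) ^ k =
      ∑ g : Fin k → Fin d, (∏ l, x (g l)) * ∏ l, z (g l) := by
  rw [PiLp.inner_apply, ← Fin.prod_const, Finset.prod_univ_sum, Fintype.piFinset_univ]
  refine Finset.sum_congr rfl fun g _ => ?_
  rw [← Finset.prod_mul_distrib]
  exact Finset.prod_congr rfl fun l _ => by simp [mul_comm]

theorem sum_sum_inner_pow_eq {d N : ℕ} (z : Fin N → EuclideanSpace ℝ (Fin d)) (b : Fin N → ℝ)
    (k : ℕ) : ∑ i, ∑ j, b i * (b j * (inner ℝ (z i) (z j) : ℝ) ^ k) =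
      ∑ g : Fin k → Fin d, (∑ i, b i * ∏ l, z i (g l)) ^ 2 := by
  have h1 : ∀ g : Fin k → Fin d, (∑ i, b i * ∏ l, z i (g l)) ^ 2 =
      ∑ i, ∑ j, b i * (b j * ((∏ l, z i (g l)) * ∏ l, z j (g l))) := by
    intro g
    rw [sq, Finset.sum_mul_sum]
    refine Finset.sum_congr rfl fun i _ => Finset.sum_congr rfl fun j _ => ?_
    ring
  simp only [h1]
  symm
  rw [Finset.sum_comm]
  refine Finset.sum_congr rfl fun i _ => ?_
  rw [Finset.sum_comm]
  refine Finset.sum_congr rfl fun j _ => ?_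
  rw [inner_pow_eq_sum]
  simp only [Finset.mul_sum]

/-- Cauchy–Schwarz in the RKHS of the polynomial kernel `⟨x, z⟩ ^ k`. -/
theorem sq_sum_inner_pow_le {d N : ℕ} (z : Fin N → EuclideanSpace ℝ (Fin d)) (b : Fin N → ℝ)
    (k : ℕ) (x : EuclideanSpace ℝ (Fin d)) :
    (∑ i, b i * (inner ℝ x (z i) : ℝ) ^ k) ^ 2 ≤
      (‖x‖ ^ 2) ^ k * ∑ i, ∑ j, b i * (b j * (inner ℝ (z i) (z j) : ℝ) ^ k) := by
  have h1 : ∑ i, b i * (inner ℝ x (z i) : ℝ) ^ k =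
      ∑ g : Fin k → Fin d, (∏ l, x (g l)) * ∑ i, b i * ∏ l, z i (g l) := by
    simp only [inner_pow_eq_sum, Finset.mul_sum]
    rw [Finset.sum_comm]
    refine Finset.sum_congr rfl fun g _ => Finset.sum_congr rfl fun i _ => ?_
    ring
  have h2 : (‖x‖ ^ 2) ^ k = ∑ g : Fin k → Fin d, (∏ l, x (g l)) ^ 2 := by
    rw [← real_inner_self_eq_norm_sq, inner_pow_eq_sum]
    simp only [sq]
  rw [h1, h2, sum_sum_inner_pow_eq]
  exact Finset.sum_mul_sq_le_sq_mul_sq _ _ _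


/-- The exponential weight in front of the polynomial part of the Gaussian kernel. -/
noncomputable def gaussianWeight {d : ℕ} (σ : ℝ) (x : EuclideanSpace ℝ (Fin d)) : ℝ :=
  Real.exp (-‖x‖ ^ 2 / (2 * σ ^ 2))

theorem gaussianWeight_pos {d : ℕ} (σ : ℝ) (x : EuclideanSpace ℝ (Fin d)) :
    0 < gaussianWeight σ x := Real.exp_pos _

theorem gaussianWeight_le_one {d : ℕ} (σ : ℝ) (x : EuclideanSpace ℝ (Fin d)) :
    gaussianWeight σ x ≤ 1 := by
  rw [gaussianWeight, Real.exp_le_one_iff, neg_div, neg_nonpos]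
  positivity

/-- The degree-`k` part of the kernel expansion `∑ i, a i * K (·, z i)`, stripped of its weight. -/
noncomputable def kernelSumPart {d N : ℕ} (σ : ℝ) (z : Fin N → EuclideanSpace ℝ (Fin d))
    (a : Fin N → ℝ) (k : ℕ) (x : EuclideanSpace ℝ (Fin d)) : ℝ :=
  ∑ i, a i * gaussianWeight σ (z i) * ((inner ℝ x (z i) / σ ^ 2) ^ k / k.factorial)

theorem hasSum_pow_div_factorial (y : ℝ) :
    HasSum (fun k : ℕ => y ^ k / k.factorial) (Real.exp y) := by
  rw [Real.exp_eq_exp_ℝ]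
  exact NormedSpace.expSeries_div_hasSum_exp y

theorem hasSum_kernelSumPart {d N : ℕ} (σ : ℝ) (z : Fin N → EuclideanSpace ℝ (Fin d))
    (a : Fin N → ℝ) (x : EuclideanSpace ℝ (Fin d)) :
    HasSum (fun k => gaussianWeight σ x * kernelSumPart σ z a k x)
      ((∑ i, RKHS.kerFun (GaussianRKHS d σ) (z i) (a i)) x) := by
  have h1 : (∑ i, RKHS.kerFun (GaussianRKHS d σ) (z i) (a i)) x = gaussianWeight σ x *
      ∑ i, a i * gaussianWeight σ (z i) * Real.exp (inner ℝ x (z i) / σ ^ 2) := by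
    rw [gaussianRKHS_kerFun_sum_apply, Finset.mul_sum]
    refine Finset.sum_congr rfl fun i _ => ?_
    rw [exp_neg_norm_sub_sq, gaussianWeight, gaussianWeight]
    ring
  rw [h1]
  exact (hasSum_sum fun i _ => (hasSum_pow_div_factorial _).mul_left _).mul_left _

/-- Each degree of a kernel expansion `h` is controlled by `‖h‖`: the squared norm is the sum over
the degrees `k` of nonnegative contributions, and the `k`-th one dominates the degree-`k` part by
Cauchy–Schwarz. -/
theorem sq_kernelSumPart_le {d N : ℕ} (σ : ℝ) (z : Fin N → EuclideanSpace ℝ (Fin d))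
    (a : Fin N → ℝ) (k : ℕ) (x : EuclideanSpace ℝ (Fin d)) :
    kernelSumPart σ z a k x ^ 2 ≤ (‖x‖ ^ 2 / σ ^ 2) ^ k / k.factorial *
      ‖∑ i, RKHS.kerFun (GaussianRKHS d σ) (z i) (a i)‖ ^ 2 := by
  set b : Fin N → ℝ := fun i => a i * gaussianWeight σ (z i) with hb
  set q : ℕ → ℝ := fun k => ((σ ^ 2) ^ k)⁻¹ * (k.factorial : ℝ)⁻¹ with hq
  have hq0 : ∀ k, 0 ≤ q k := fun k => by positivity
  have hsum : HasSum (fun k => q k * ∑ i, ∑ j, b i * (b j * (inner ℝ (z i) (z j) : ℝ) ^ k))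
      (‖∑ i, RKHS.kerFun (GaussianRKHS d σ) (z i) (a i)‖ ^ 2) := by
    rw [gaussianRKHS_norm_kerFun_sum_sq]
    have h2 : HasSum (fun k : ℕ => ∑ i, ∑ j, b i * (b j *
        ((inner ℝ (z i) (z j) / σ ^ 2) ^ k / k.factorial)))
        (∑ i, ∑ j, b i * (b j * Real.exp (inner ℝ (z i) (z j) / σ ^ 2))) :=
      hasSum_sum fun i _ => hasSum_sum fun j _ =>
        ((hasSum_pow_div_factorial _).mul_left _).mul_left _
    convert h2 using 1
    · funext k
      simp only [Finset.mul_sum, hq, div_pow]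
      refine Finset.sum_congr rfl fun i _ => Finset.sum_congr rfl fun j _ => ?_
      ring
    · refine Finset.sum_congr rfl fun i _ => Finset.sum_congr rfl fun j _ => ?_
      rw [exp_neg_norm_sub_sq, hb]
      simp only [gaussianWeight]
      ring
  have hle : q k * ∑ i, ∑ j, b i * (b j * (inner ℝ (z i) (z j) : ℝ) ^ k) ≤
      ‖∑ i, RKHS.kerFun (GaussianRKHS d σ) (z i) (a i)‖ ^ 2 := by
    refine le_hasSum hsum k fun l _ => mul_nonneg (hq0 l) ?_
    rw [sum_sum_inner_pow_eq]
    positivity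
  have hpart : kernelSumPart σ z a k x = q k * ∑ i, b i * (inner ℝ x (z i) : ℝ) ^ k := by
    simp only [kernelSumPart, Finset.mul_sum, hq, hb, div_pow]
    refine Finset.sum_congr rfl fun i _ => ?_
    ring
  calc kernelSumPart σ z a k x ^ 2 = q k ^ 2 * (∑ i, b i * (inner ℝ x (z i) : ℝ) ^ k) ^ 2 := by
        rw [hpart, mul_pow]
    _ ≤ q k ^ 2 * ((‖x‖ ^ 2) ^ k *
          ∑ i, ∑ j, b i * (b j * (inner ℝ (z i) (z j) : ℝ) ^ k)) := by
        gcongr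
        exact sq_sum_inner_pow_le z b k x
    _ = (q k * (‖x‖ ^ 2) ^ k) *
          (q k * ∑ i, ∑ j, b i * (b j * (inner ℝ (z i) (z j) : ℝ) ^ k)) := by ring
    _ ≤ (q k * (‖x‖ ^ 2) ^ k) *
          ‖∑ i, RKHS.kerFun (GaussianRKHS d σ) (z i) (a i)‖ ^ 2 := by
        have := hq0 k
        gcongr
    _ = _ := by
        simp only [hq, div_pow]
        ring

theorem abs_kernelSumPart_le {d N : ℕ} {σ ρ : ℝ}
    (z : Fin N → EuclideanSpace ℝ (Fin d)) (a : Fin N → ℝ) (k : ℕ)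
    {x : EuclideanSpace ℝ (Fin d)} (hx : ‖x‖ ^ 2 / σ ^ 2 ≤ ρ) :
    |kernelSumPart σ z a k x| ≤ Real.exp (ρ * Real.exp 2 / 2) *
      ‖∑ i, RKHS.kerFun (GaussianRKHS d σ) (z i) (a i)‖ * Real.exp (-1) ^ k := by
  refine abs_le_of_sq_le_sq ?_ (by positivity)
  refine (sq_kernelSumPart_le σ z a k x).trans ?_
  -- `ρ ^ k / k! = (ρ e²) ^ k / k! * e ^ (-2 k)`, and the first factor is a term of `exp (ρ e²)`.
  have hρ : 0 ≤ ρ := le_trans (by positivity) hx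
  have h1 : (ρ * Real.exp 2) ^ k / k.factorial ≤ Real.exp (ρ * Real.exp 2) :=
    Real.pow_div_factorial_le_exp _ (by positivity) k
  have h2 : Real.exp 2 * Real.exp (-1) ^ 2 = 1 := by
    rw [sq, ← Real.exp_add, ← Real.exp_add]
    norm_num
  have h3 : Real.exp (ρ * Real.exp 2 / 2) ^ 2 = Real.exp (ρ * Real.exp 2) := by
    rw [sq, ← Real.exp_add]
    ring_nf
  calc (‖x‖ ^ 2 / σ ^ 2) ^ k / k.factorial *
        ‖∑ i, RKHS.kerFun (GaussianRKHS d σ) (z i) (a i)‖ ^ 2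
      ≤ ρ ^ k / k.factorial * ‖∑ i, RKHS.kerFun (GaussianRKHS d σ) (z i) (a i)‖ ^ 2 := by
        gcongr
    _ = ((ρ * Real.exp 2) ^ k / k.factorial) * (Real.exp (-1) ^ 2) ^ k *
        ‖∑ i, RKHS.kerFun (GaussianRKHS d σ) (z i) (a i)‖ ^ 2 := by
        have : ρ ^ k = (ρ * Real.exp 2) ^ k * (Real.exp (-1) ^ 2) ^ k := by
          rw [← mul_pow, mul_assoc, h2, mul_one]
        rw [this]
        ring
    _ ≤ Real.exp (ρ * Real.exp 2) * (Real.exp (-1) ^ 2) ^ k *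
        ‖∑ i, RKHS.kerFun (GaussianRKHS d σ) (z i) (a i)‖ ^ 2 := by
        gcongr
    _ = _ := by
        rw [mul_pow, mul_pow, h3, ← pow_mul, ← pow_mul, mul_comm 2 k]
        ring

/-- Truncating the kernel expansion of `h` at degree `m` costs `O(e⁻ᵐ ‖h‖)` on bounded sets. -/
theorem abs_sub_sum_kernelSumPart_le {d N : ℕ} {σ ρ : ℝ}
    (z : Fin N → EuclideanSpace ℝ (Fin d)) (a : Fin N → ℝ) (m : ℕ)
    {x : EuclideanSpace ℝ (Fin d)} (hx : ‖x‖ ^ 2 / σ ^ 2 ≤ ρ) :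
    |(∑ i, RKHS.kerFun (GaussianRKHS d σ) (z i) (a i)) x -
      ∑ k ∈ Finset.range m, gaussianWeight σ x * kernelSumPart σ z a k x| ≤
      2 * Real.exp (ρ * Real.exp 2 / 2) * Real.exp (-m) *
        ‖∑ i, RKHS.kerFun (GaussianRKHS d σ) (z i) (a i)‖ := by
  have hr : Real.exp (-1) ≤ 1 / 2 := by
    have := Real.exp_one_gt_d9
    rw [Real.exp_neg, ← one_div]
    exact one_div_le_one_div_of_le (by norm_num) (by linarith)
  have h := norm_sub_le_of_geometric_bound_of_hasSum (r := Real.exp (-1))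
    (C := Real.exp (ρ * Real.exp 2 / 2) *
      ‖∑ i, RKHS.kerFun (GaussianRKHS d σ) (z i) (a i)‖) (by linarith) (fun k => ?_)
    (hasSum_kernelSumPart σ z a x) m
  · rw [← Real.norm_eq_abs, norm_sub_rev]
    refine h.trans ?_
    rw [← Real.exp_nat_mul, mul_neg_one, div_le_iff₀ (by linarith)]
    have h1 : 1 ≤ 2 * (1 - Real.exp (-1)) := by linarith
    have h2 : 0 ≤ Real.exp (ρ * Real.exp 2 / 2) *
      ‖∑ i, RKHS.kerFun (GaussianRKHS d σ) (z i) (a i)‖ * Real.exp (-m) := by positivity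
    nlinarith
  · rw [norm_mul, Real.norm_of_nonneg (gaussianWeight_pos σ x).le, Real.norm_eq_abs]
    calc gaussianWeight σ x * |kernelSumPart σ z a k x| ≤ 1 * |kernelSumPart σ z a k x| := by
          gcongr
          exact gaussianWeight_le_one σ x
      _ ≤ _ := by
          rw [one_mul]
          exact abs_kernelSumPart_le z a k hx

/-- The functions spanning the approximation spaces: the constant function `1`, indexed by `none`,
and the weighted monomials of degree less than `m` in each variable. -/
noncomputable def approxBasis (d : ℕ) (σ : ℝ) (m : ℕ) :
    Option (Fin d → Fin m) → EuclideanSpace ℝ (Fin d) → ℝ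
  | none => 1
  | some α => fun x => gaussianWeight σ x * ∏ i, x i ^ (α i : ℕ)

theorem continuous_approxBasis (d : ℕ) (σ : ℝ) (m : ℕ) (o : Option (Fin d → Fin m)) :
    Continuous (approxBasis d σ m o) := by
  rcases o with _ | α
  · exact continuous_const
  · change Continuous fun x : EuclideanSpace ℝ (Fin d) =>
      Real.exp (-‖x‖ ^ 2 / (2 * σ ^ 2)) * ∏ i, x i ^ (α i : ℕ)
    fun_prop

theorem weighted_monomial_mem_span {d m k : ℕ} (σ : ℝ) (hk : k < m) (g : Fin k → Fin d) :
    (fun x => gaussianWeight σ x * ∏ l, x (g l)) ∈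
      Submodule.span ℝ (Set.range (approxBasis d σ m)) := by
  refine Submodule.subset_span ⟨some fun j => ⟨(Finset.univ.filter fun l => g l = j).card,
    (Finset.card_le_univ _).trans_lt (by simpa using hk)⟩, ?_⟩
  funext x
  simp only [approxBasis]
  rw [← Finset.prod_fiberwise (s := Finset.univ) (g := g) (f := fun l => x (g l))]
  congr 1
  refine Finset.prod_congr rfl fun j _ => ?_
  rw [Finset.prod_congr rfl (g := fun _ => x j), Finset.prod_const]
  intro l hl
  rw [(Finset.mem_filter.1 hl).2]

theorem weighted_kernelSumPart_mem_span {d N m k : ℕ} (σ : ℝ) (hk : k < m)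
    (z : Fin N → EuclideanSpace ℝ (Fin d)) (a : Fin N → ℝ) :
    (fun x => gaussianWeight σ x * kernelSumPart σ z a k x) ∈
      Submodule.span ℝ (Set.range (approxBasis d σ m)) := by
  have h : (fun x => gaussianWeight σ x * kernelSumPart σ z a k x) =
      ∑ i, ∑ g : Fin k → Fin d, (a i * gaussianWeight σ (z i) * ((σ ^ 2) ^ k)⁻¹ *
        (k.factorial : ℝ)⁻¹ * ∏ l, z i (g l)) • fun x => gaussianWeight σ x * ∏ l, x (g l) := by
    funext x
    simp only [Finset.sum_apply, Pi.smul_apply, smul_eq_mul, kernelSumPart, div_pow,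
      inner_pow_eq_sum, Finset.mul_sum, Finset.sum_div]
    refine Finset.sum_congr rfl fun i _ => Finset.sum_congr rfl fun g _ => ?_
    ring
  rw [h]
  exact Submodule.sum_mem _ fun i _ => Submodule.sum_mem _ fun g _ =>
    Submodule.smul_mem _ _ (weighted_monomial_mem_span σ hk g)

/-- Rational coefficients suffice to approximate, uniformly on a bounded set, a function in the
span of finitely many continuous functions. -/
theorem exists_rat_approx_of_mem_span {E ι : Type*} [TopologicalSpace E] [Fintype ι]
    {φ : ι → E → ℝ} (hφ : ∀ o, Continuous (φ o)) {K : Set E} (hK : IsCompact K) {f : E → ℝ}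
    (hf : f ∈ Submodule.span ℝ (Set.range φ)) {η : ℝ} (hη : 0 < η) :
    ∃ c : ι → ℚ, ∀ x ∈ K, |f x - ∑ o, (c o : ℝ) * φ o x| ≤ η := by
  obtain ⟨c, rfl⟩ := (Submodule.mem_span_range_iff_exists_fun ℝ).1 hf
  choose M hM using fun o => hK.exists_bound_of_continuousOn (hφ o).continuousOn
  have hδ : ∀ o, ∃ r : ℚ, |c o - r| < η / ((Fintype.card ι + 1) * (|M o| + 1)) := fun o =>
    exists_rat_near _ (by positivity)
  choose r hr using hδ
  refine ⟨r, fun x hx => ?_⟩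
  have h1 : (∑ o, c o • φ o) x - ∑ o, (r o : ℝ) * φ o x = ∑ o, (c o - r o) * φ o x := by
    simp [Finset.sum_apply, sub_mul, Finset.sum_sub_distrib]
  rw [h1]
  refine (Finset.abs_sum_le_sum_abs _ _).trans ?_
  have h2 : ∀ o ∈ Finset.univ, |(c o - r o) * φ o x| ≤ η / (Fintype.card ι + 1) := by
    intro o _
    rw [abs_mul]
    calc |c o - r o| * |φ o x|
        ≤ η / ((Fintype.card ι + 1) * (|M o| + 1)) * (|M o| + 1) := by
          gcongr
          · exact (hr o).le
          · exact (hM o x hx).trans ((le_abs_self _).trans (by linarith))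
      _ = η / (Fintype.card ι + 1) := by field_simp
  refine (Finset.sum_le_sum h2).trans ?_
  rw [Finset.sum_const, Finset.card_univ, nsmul_eq_mul, mul_div_assoc', div_le_iff₀ (by positivity)]
  nlinarith

/-- On the ball of radius `L`, an element `h` of the Gaussian RKHS plus a constant is approximated
up to an exponentially small multiple of `‖h‖` by combinations of `m ^ d + 1` fixed functions. -/
theorem gaussianRKHS_exists_rat_approx {d : ℕ} {σ L : ℝ} (h : GaussianRKHS d σ) (b : ℝ) (m : ℕ)
    {η : ℝ} (hη : 0 < η) :
    ∃ c : Option (Fin d → Fin m) → ℚ, ∀ x ∈ Metric.closedBall (0 : EuclideanSpace ℝ (Fin d)) L,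
      |h x + b - ∑ o, (c o : ℝ) * approxBasis d σ m o x| ≤
        2 * Real.exp (L ^ 2 / σ ^ 2 * Real.exp 2 / 2) * Real.exp (-m) * ‖h‖ + η := by
  set C := 2 * Real.exp (L ^ 2 / σ ^ 2 * Real.exp 2 / 2) * Real.exp (-m) with hC
  have hC0 : 0 < C := by positivity
  obtain ⟨N, z, a, hza⟩ := gaussianRKHS_exists_kerFun_sum h
    (show 0 < η / (2 * (1 + C)) by positivity)
  set g : GaussianRKHS d σ := ∑ i, RKHS.kerFun (GaussianRKHS d σ) (z i) (a i) with hg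
  have hmem : (fun x => ∑ k ∈ Finset.range m, gaussianWeight σ x * kernelSumPart σ z a k x + b) ∈
      Submodule.span ℝ (Set.range (approxBasis d σ m)) := by
    have h1 : (fun x => ∑ k ∈ Finset.range m, gaussianWeight σ x * kernelSumPart σ z a k x + b) =
        (∑ k ∈ Finset.range m, fun x => gaussianWeight σ x * kernelSumPart σ z a k x) +
          b • approxBasis d σ m none := by
      funext x
      simp [approxBasis]
    rw [h1]
    refine Submodule.add_mem _ (Submodule.sum_mem _ fun k hk => ?_)
      (Submodule.smul_mem _ _ (Submodule.subset_span ⟨none, rfl⟩))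
    exact weighted_kernelSumPart_mem_span σ (Finset.mem_range.1 hk) z a
  obtain ⟨c, hc⟩ := exists_rat_approx_of_mem_span (continuous_approxBasis d σ m)
    (isCompact_closedBall (0 : EuclideanSpace ℝ (Fin d)) L) hmem (half_pos hη)
  refine ⟨c, fun x hx => ?_⟩
  have hxL : ‖x‖ ^ 2 / σ ^ 2 ≤ L ^ 2 / σ ^ 2 := by
    rw [mem_closedBall_zero_iff] at hx
    gcongr
  have e1 : |h x - g x| ≤ η / (2 * (1 + C)) := by
    have := gaussianRKHS_abs_apply_le (h - g) x
    rw [RKHS.coe_sub, Pi.sub_apply] at this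
    exact this.trans hza.le
  have e2 := abs_sub_sum_kernelSumPart_le z a m hxL
  rw [← hg, ← hC] at e2
  have e3 := hc x hx
  have e4 : ‖g‖ ≤ ‖h‖ + η / (2 * (1 + C)) := by
    have := norm_le_norm_add_norm_sub h g
    linarith
  have e5 : C * ‖g‖ ≤ C * ‖h‖ + C * (η / (2 * (1 + C))) := by
    rw [← mul_add]
    gcongr
  have e6 : η / (2 * (1 + C)) + C * (η / (2 * (1 + C))) = η / 2 := by
    field_simp
  rw [abs_le] at *
  constructor <;> linarith [e1.1, e1.2, e2.1, e2.2, e3.1, e3.2]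

/-! ### Sign patterns of finite-dimensional function spaces -/

open Classical in
/-- The traces on the points `x` of the sets `{f > 0}`, for `f` in the class `F`. -/
noncomputable def signPatterns {X : Type*} (F : Set (X → ℝ)) {n : ℕ} (x : Fin n → X) :
    Finset (Finset (Fin n)) :=
  Finset.univ.filter fun A => ∃ f ∈ F, ∀ i, i ∈ A ↔ 0 < f (x i)

theorem mem_signPatterns {X : Type*} {F : Set (X → ℝ)} {n : ℕ} {x : Fin n → X}
    {A : Finset (Fin n)} : A ∈ signPatterns F x ↔ ∃ f ∈ F, ∀ i, i ∈ A ↔ 0 < f (x i) := by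
  simp [signPatterns]

/-- The positivity sets of a space spanned by `D` functions have Vapnik–Chervonenkis dimension at
most `D`: more than `D` points satisfy a linear relation `∑ g i * f (x i) = 0` valid for all `f`
in the space, so no `f` can be positive exactly where `g` is. -/
theorem card_le_of_shatters_signPatterns {X ι : Type*} [Fintype ι] {φ : ι → X → ℝ}
    {F : Set (X → ℝ)} (hF : F ⊆ Submodule.span ℝ (Set.range φ)) {n : ℕ} {x : Fin n → X}
    {s : Finset (Fin n)} (hs : (signPatterns F x).Shatters s) : s.card ≤ Fintype.card ι := by
  by_contra! hcard
  have hdep : ¬ LinearIndependent ℝ (fun (i : s) (o : ι) => φ o (x i)) := fun h => by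
    have := h.fintype_card_le_finrank
    simp only [Fintype.card_coe, Module.finrank_fintype_fun_eq_card] at this
    omega
  obtain ⟨g, hg, i₀, hi₀⟩ := Fintype.not_linearIndependent_iff.1 hdep
  have key : ∀ g : s → ℝ, (∑ i, g i • (fun o : ι => φ o (x i)) = 0) → ∀ i₀, 0 < g i₀ → False := by
    intro g hg i₀ hi₀
    obtain ⟨u, hu, hsu⟩ := hs (t := (Finset.univ.filter fun i => 0 < g i).map
      (Function.Embedding.subtype _)) (by
        intro i hi
        obtain ⟨j, -, rfl⟩ := Finset.mem_map.1 hi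
        exact j.2)
    obtain ⟨f, hfF, hf⟩ := mem_signPatterns.1 hu
    obtain ⟨c, rfl⟩ := (Submodule.mem_span_range_iff_exists_fun ℝ).1 (hF hfF)
    have hmem : ∀ i : s, 0 < g i ↔ (i : Fin n) ∈ u := by
      intro i
      have h1 := Finset.ext_iff.1 hsu i
      simp only [Finset.mem_inter, i.2, true_and, Finset.mem_map, Finset.mem_filter,
        Finset.mem_univ, Function.Embedding.subtype_apply, SetLike.coe_eq_coe, exists_eq_right] at h1
      exact h1.symm
    have hzero : ∑ i, g i * (∑ o, c o • φ o) (x i) = 0 := by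
      have h1 : ∀ o, ∑ i, g i * φ o (x i) = 0 := fun o => by
        simpa [Finset.sum_apply] using congrFun hg o
      simp only [Finset.sum_apply, Pi.smul_apply, smul_eq_mul, Finset.mul_sum]
      rw [Finset.sum_comm]
      refine Finset.sum_eq_zero fun o _ => ?_
      rw [← mul_zero (c o), ← h1 o, Finset.mul_sum]
      exact Finset.sum_congr rfl fun i _ => by ring
    have hnonneg : ∀ i ∈ Finset.univ, 0 ≤ g i * (∑ o, c o • φ o) (x i) := by
      intro i _
      rcases lt_or_ge 0 (g i) with h | h
      · exact mul_nonneg h.le ((hf i).1 ((hmem i).1 h)).le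
      · exact mul_nonneg_of_nonpos_of_nonpos h
          (not_lt.1 fun h' => h.not_gt ((hmem i).2 ((hf i).2 h')))
    have h0 := (Finset.sum_eq_zero_iff_of_nonneg hnonneg).1 hzero i₀ (Finset.mem_univ _)
    exact (mul_pos hi₀ ((hf i₀).1 ((hmem i₀).1 hi₀))).ne' h0
  -- Up to a sign, the relation has a positive coefficient.
  rcases lt_or_gt_of_ne hi₀ with h | h
  · exact key (-g) (by simpa [neg_smul, Finset.sum_neg_distrib] using hg) i₀ (by simpa using h)
  · exact key g hg i₀ h

/-- The exponential-moment bound on a partial sum of binomial coefficients. -/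
theorem sum_choose_mul_pow_le {l : ℝ} (hl : 0 < l) (hl1 : l ≤ 1) (n D : ℕ) :
    (∑ k ∈ Finset.Iic D, (n.choose k : ℝ)) ≤ (1 + l) ^ n * l⁻¹ ^ D := by
  rw [inv_pow, ← div_eq_mul_inv, le_div_iff₀ (by positivity), Finset.sum_mul]
  calc ∑ k ∈ Finset.Iic D, (n.choose k : ℝ) * l ^ D
      ≤ ∑ k ∈ Finset.Iic D, (n.choose k : ℝ) * l ^ k := by
        refine Finset.sum_le_sum fun k hk => ?_
        have := pow_le_pow_of_le_one hl.le hl1 (Finset.mem_Iic.1 hk)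
        gcongr
    _ ≤ ∑ k ∈ Finset.range (n + D + 1), (n.choose k : ℝ) * l ^ k := by
        refine Finset.sum_le_sum_of_subset_of_nonneg (fun k hk => ?_) fun _ _ _ => by positivity
        have := Finset.mem_Iic.1 hk
        exact Finset.mem_range.2 (by omega)
    _ = ∑ k ∈ Finset.range (n + 1), (n.choose k : ℝ) * l ^ k := by
        symm
        refine Finset.sum_subset (fun k hk => ?_) fun k _ hk => ?_
        · have := Finset.mem_range.1 hk
          exact Finset.mem_range.2 (by omega)
        · rw [Finset.mem_range, not_lt] at hk
          rw [Nat.choose_eq_zero_of_lt (by omega)]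
          simp
    _ = (1 + l) ^ n := by
        rw [add_comm 1 l, add_pow]
        exact Finset.sum_congr rfl fun k _ => by rw [one_pow, mul_one, mul_comm]

theorem card_signPatterns_le {X ι : Type*} [Fintype ι] {φ : ι → X → ℝ}
    {F : Set (X → ℝ)} (hF : F ⊆ Submodule.span ℝ (Set.range φ)) {n : ℕ} (x : Fin n → X)
    {l : ℝ} (hl : 0 < l) (hl1 : l ≤ 1) :
    ((signPatterns F x).card : ℝ) ≤ (1 + l) ^ n * l⁻¹ ^ Fintype.card ι := by
  have hvc : (signPatterns F x).vcDim ≤ Fintype.card ι :=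
    Finset.sup_le fun s hs => card_le_of_shatters_signPatterns hF (Finset.mem_shatterer.1 hs)
  have h1 := (Finset.card_le_card_shatterer (signPatterns F x)).trans
    (Finset.card_shatterer_le_sum_vcDim (𝒜 := signPatterns F x))
  rw [Fintype.card_fin] at h1
  refine le_trans ?_ (sum_choose_mul_pow_le hl hl1 n (Fintype.card ι))
  calc ((signPatterns F x).card : ℝ)
      ≤ ∑ k ∈ Finset.Iic (signPatterns F x).vcDim, (n.choose k : ℝ) := by exact_mod_cast h1
    _ ≤ _ := Finset.sum_le_sum_of_subset_of_nonneg (Finset.Iic_subset_Iic.2 hvc)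
        fun _ _ _ => by positivity

theorem measurableSet_mem_signPatterns {X : Type*} [MeasurableSpace X] {F : Set (X → ℝ)}
    (hFc : F.Countable) (hF : ∀ f ∈ F, Measurable f) {n : ℕ} (A : Finset (Fin n)) :
    MeasurableSet {x : Fin n → X | A ∈ signPatterns F x} := by
  simp only [mem_signPatterns]
  have h1 : {x : Fin n → X | ∃ f ∈ F, ∀ i, i ∈ A ↔ 0 < f (x i)} =
      ⋃ f ∈ F, ⋂ i, {x | i ∈ A ↔ 0 < f (x i)} := by
    ext x
    simp
  rw [h1]
  refine MeasurableSet.biUnion hFc fun f hf => MeasurableSet.iInter fun i => ?_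
  have hm : MeasurableSet {x : Fin n → X | 0 < f (x i)} :=
    measurableSet_lt measurable_const ((hF f hf).comp (measurable_pi_apply i))
  exact (MeasurableSet.const _).iff hm

/-! ### Random labels and the noise level -/

theorem lintegral_pi_prod {X : Type*} [MeasurableSpace X] (μ : Measure X) [IsProbabilityMeasure μ]
    {n : ℕ} {f : Fin n → X → ENNReal} (hf : ∀ i, Measurable (f i)) :
    ∫⁻ x, ∏ i, f i (x i) ∂(Measure.pi fun _ : Fin n => μ) = ∏ i, ∫⁻ a, f i a ∂μ := by
  have h := lintegral_prod_eq_prod_lintegral_of_indepFun Finset.univ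
    (fun i (x : Fin n → X) => f i (x i))
    (iIndepFun_pi (μ := fun _ : Fin n => μ) fun i => (hf i).aemeasurable)
    (fun i => (hf i).comp (measurable_pi_apply i))
  rw [h]
  refine Finset.prod_congr rfl fun i _ => ?_
  exact (measurePreserving_eval (fun _ : Fin n => μ) i).lintegral_comp (hf i)

/-- Given the points `x` of an independent sample, the labels are independent, the `i`-th one
having the conditional law at `x i`. -/
theorem pi_setOf_labels_mem {X : Type*} [MeasurableSpace X] (P : Measure (X × ℝ))
    [IsProbabilityMeasure P] {n : ℕ} {e : Fin n → Set ℝ} (he : ∀ i, MeasurableSet (e i))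
    {Q : Set (Fin n → X)} (hQ : MeasurableSet Q) :
    Measure.pi (fun _ : Fin n => P) {s | (fun i => (s i).1) ∈ Q ∧ ∀ i, (s i).2 ∈ e i} =
      ∫⁻ x in Q, ∏ i, P.condKernel (x i) (e i) ∂(Measure.pi fun _ : Fin n => P.fst) := by
  set R : Fin n → Set (X × ℝ) := fun i => Prod.snd ⁻¹' e i with hR
  have hRm : ∀ i, MeasurableSet (R i) := fun i => measurable_snd (he i)
  set ν : Fin n → Measure X := fun i => (P.restrict (R i)).map Prod.fst with hν
  have hk : ∀ i, Measurable fun a => P.condKernel a (e i) := fun i =>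
    Kernel.measurable_coe _ (he i)
  -- Both sides are the mass of `Q` under the product of the laws of a point whose label is in `e i`.
  have h1 : (Measure.pi fun i => P.restrict (R i)).map (fun s i => (s i).1) = Measure.pi ν :=
    Measure.pi_map_pi fun i => measurable_fst.aemeasurable
  have h2 : Measure.pi ν = (Measure.pi fun _ : Fin n => P.fst).withDensity
      fun x => ∏ i, P.condKernel (x i) (e i) := by
    refine Measure.pi_eq fun B hB => ?_
    rw [withDensity_apply _ (MeasurableSet.univ_pi hB), ← lintegral_indicator
      (MeasurableSet.univ_pi hB)]
    have h3 : (Set.univ.pi B).indicator (fun x => ∏ i, P.condKernel (x i) (e i)) =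
        fun x => ∏ i, (B i).indicator (fun a => P.condKernel a (e i)) (x i) := by
      funext x
      by_cases hx : x ∈ Set.univ.pi B
      · rw [Set.indicator_of_mem hx]
        exact Finset.prod_congr rfl fun i _ =>
          (Set.indicator_of_mem (hx i (Set.mem_univ i)) (fun a => P.condKernel a (e i))).symm
      · rw [Set.indicator_of_notMem hx]
        simp only [Set.mem_univ_pi, not_forall] at hx
        obtain ⟨i, hi⟩ := hx
        exact (Finset.prod_eq_zero (Finset.mem_univ i) (Set.indicator_of_notMem hi _)).symm
    rw [h3, lintegral_pi_prod _ fun i => (hk i).indicator (hB i)]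
    refine Finset.prod_congr rfl fun i _ => ?_
    rw [lintegral_indicator (hB i), hν, Measure.map_apply measurable_fst (hB i),
      Measure.restrict_apply (measurable_fst (hB i))]
    have h4 : Prod.fst ⁻¹' B i ∩ R i = B i ×ˢ e i := by
      ext p; simp [hR]
    rw [h4]
    conv_rhs => rw [← P.disintegrate P.condKernel]
    rw [Measure.compProd_apply_prod (hB i) (he i)]
  have hproj : Measurable fun (s : Fin n → X × ℝ) i => (s i).1 := by fun_prop
  rw [← withDensity_apply _ hQ, ← h2, ← h1, Measure.map_apply hproj hQ, ← Measure.restrict_pi_pi,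
    Measure.restrict_apply (hproj hQ)]
  congr 1
  ext s
  simp [hR]

/-- The points at which one of the labels `1`, `-1` has conditional probability less than `κ`. -/
noncomputable def lowNoiseSet {X : Type*} [MeasurableSpace X] (P : Measure (X × ℝ))
    [IsFiniteMeasure P] (κ : ENNReal) : Set X :=
  {x | P.condKernel x {1} < κ ∨ P.condKernel x {-1} < κ}

theorem measurableSet_lowNoiseSet {X : Type*} [MeasurableSpace X] (P : Measure (X × ℝ))
    [IsFiniteMeasure P] (κ : ENNReal) : MeasurableSet (lowNoiseSet P κ) :=
  (measurableSet_lt (Kernel.measurable_coe _ (measurableSet_singleton _)) measurable_const).union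
    (measurableSet_lt (Kernel.measurable_coe _ (measurableSet_singleton _)) measurable_const)

theorem condKernel_le_of_notMem_lowNoiseSet {X : Type*} [MeasurableSpace X] {P : Measure (X × ℝ)}
    [IsFiniteMeasure P] {κ : ENNReal} {x : X} (hx : x ∉ lowNoiseSet P κ) :
    P.condKernel x {1} ≤ 1 - κ ∧ P.condKernel x {-1} ≤ 1 - κ := by
  simp only [lowNoiseSet, Set.mem_ofPred_eq, not_or, not_lt] at hx
  have hsum : P.condKernel x {1} + P.condKernel x {-1} ≤ 1 := by
    rw [← measure_union (by simp; norm_num) (measurableSet_singleton _)]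
    exact prob_le_one
  have hκ : κ ≠ ⊤ := ne_top_of_le_ne_top (measure_ne_top _ _) hx.1
  refine ⟨ENNReal.le_sub_of_add_le_right hκ ?_, ENNReal.le_sub_of_add_le_right hκ ?_⟩
  · exact (add_le_add_right hx.2 _).trans hsum
  · exact (add_le_add_right hx.1 _).trans ((add_comm _ _).le.trans hsum)

/-- A deterministic label of probability `1` exists on the set where one of the two labels has
conditional probability `0`. -/
theorem deterministicOn_of_condKernel_eq_zero {X : Type*} [MeasurableSpace X]
    {P : Measure (X × ℝ)} [IsFiniteMeasure P] (hP : ∀ᵐ p ∂P, p.2 = 1 ∨ p.2 = -1) :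
    DeterministicOn P {x | P.condKernel x {1} = 0 ∨ P.condKernel x {-1} = 0} := by
  classical
  have hm : ∀ c : ℝ, Measurable fun x => P.condKernel x {c} := fun c =>
    Kernel.measurable_coe _ (measurableSet_singleton c)
  have hm0 : ∀ c : ℝ, MeasurableSet {x | P.condKernel x {c} = 0} := fun c =>
    hm c (measurableSet_singleton 0)
  have hc : Measurable fun x => if P.condKernel x {1} = 0 then (-1 : ℝ) else 1 :=
    Measurable.ite (hm0 1) measurable_const measurable_const
  refine ⟨_, hc, ?_⟩
  have hP' := hP
  rw [← P.disintegrate P.condKernel] at hP'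
  have hae := Measure.ae_ae_of_ae_compProd hP'
  suffices h : ∀ᵐ p ∂(P.fst ⊗ₘ P.condKernel),
      p.1 ∈ {x | P.condKernel x {1} = 0 ∨ P.condKernel x {-1} = 0} →
        p.2 = if P.condKernel p.1 {1} = 0 then (-1 : ℝ) else 1 by
    rwa [P.disintegrate P.condKernel] at h
  rw [Measure.ae_compProd_iff]
  · filter_upwards [hae] with x hx
    by_cases h1 : P.condKernel x {1} = 0
    · have : ∀ᵐ y ∂P.condKernel x, y ≠ 1 := by
        rw [ae_iff]
        simpa using h1
      filter_upwards [hx, this] with y hy hy1 _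
      simp only [h1, if_true]
      exact hy.resolve_left hy1
    · simp only [h1, if_false, false_or]
      by_cases h2 : P.condKernel x {-1} = 0
      · have : ∀ᵐ y ∂P.condKernel x, y ≠ -1 := by
          rw [ae_iff]
          simpa using h2
        filter_upwards [hx, this] with y hy hy1 _
        exact hy.resolve_right hy1
      · simp [h2]
  · have h1 : MeasurableSet {p : X × ℝ | p.1 ∈
        {x | P.condKernel x {1} = 0 ∨ P.condKernel x {-1} = 0}} :=
      measurable_fst ((hm0 1).union (hm0 (-1)))
    exact h1.imp (measurableSet_eq_fun measurable_snd (hc.comp measurable_fst))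

/-- If the sets with deterministic labels have probability less than `β`, so has the set of low
noise, for a small enough noise level. -/
theorem exists_lowNoiseSet_lt {X : Type*} [MeasurableSpace X]
    {P : Measure (X × ℝ)} [IsProbabilityMeasure P] (hP : ∀ᵐ p ∂P, p.2 = 1 ∨ p.2 = -1) {β : ℝ}
    (hdet : ∀ S : Set X, MeasurableSet S → DeterministicOn P S → P.fst.real S < β) :
    ∃ κ : ℝ, 0 < κ ∧ κ < 1 ∧ P.fst.real (lowNoiseSet P (ENNReal.ofReal κ)) < β := by
  set u : ℕ → ℝ := fun k => 1 / ((k : ℝ) + 2) with hu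
  have hu0 : ∀ k, 0 < u k := fun k => by positivity
  have hu1 : ∀ k, u k < 1 := fun k => by
    rw [hu, div_lt_one (by positivity)]
    have : (0 : ℝ) ≤ k := k.cast_nonneg
    linarith
  have hanti : Antitone u := fun i j hij => by
    simp only [hu]
    gcongr
  have hulim : Tendsto u atTop (𝓝 0) := by
    have := (tendsto_one_div_add_atTop_nhds_zero_nat (𝕜 := ℝ)).comp (tendsto_add_atTop_nat 1)
    refine this.congr fun k => ?_
    simp only [Function.comp_apply, hu]
    push_cast
    ring
  set S : ℕ → Set X := fun k => lowNoiseSet P (ENNReal.ofReal (u k)) with hS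
  have hSanti : Antitone S := fun i j hij x hx => by
    have := ENNReal.ofReal_le_ofReal (hanti hij)
    exact hx.imp (fun h => h.trans_le this) fun h => h.trans_le this
  have hInter : ⋂ k, S k = {x | P.condKernel x {1} = 0 ∨ P.condKernel x {-1} = 0} := by
    ext x
    simp only [Set.mem_iInter, Set.mem_ofPred_eq]
    constructor
    · intro h
      by_contra! hne
      have hmin : 0 < min (P.condKernel x {1}) (P.condKernel x {-1}) :=
        lt_min (pos_iff_ne_zero.2 hne.1) (pos_iff_ne_zero.2 hne.2)
      have hlim : Tendsto (fun k => ENNReal.ofReal (u k)) atTop (𝓝 0) := by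
        simpa using ENNReal.tendsto_ofReal hulim
      obtain ⟨k, hk⟩ := (hlim.eventually (gt_mem_nhds hmin)).exists
      rcases h k with h | h
      · exact absurd (h.trans (hk.trans_le (min_le_left _ _))) (lt_irrefl _)
      · exact absurd (h.trans (hk.trans_le (min_le_right _ _))) (lt_irrefl _)
    · intro h k
      have : 0 < ENNReal.ofReal (u k) := ENNReal.ofReal_pos.2 (hu0 k)
      exact h.imp (fun h => h.trans_lt this) fun h => h.trans_lt this
  have hlim := tendsto_measure_iInter_atTop (μ := P.fst)
    (fun k => (measurableSet_lowNoiseSet P (ENNReal.ofReal (u k))).nullMeasurableSet) hSanti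
    ⟨0, measure_ne_top _ _⟩
  have hlim' : Tendsto (fun k => P.fst.real (S k)) atTop (𝓝 (P.fst.real (⋂ k, S k))) :=
    (ENNReal.tendsto_toReal (measure_ne_top _ _)).comp hlim
  have hlt : P.fst.real (⋂ k, S k) < β := by
    refine hdet _ (MeasurableSet.iInter fun k => measurableSet_lowNoiseSet P _) ?_
    rw [hInter]
    exact deterministicOn_of_condKernel_eq_zero hP
  obtain ⟨k, hk⟩ := (hlim'.eventually (gt_mem_nhds hlt)).exists
  exact ⟨u k, hu0 k, hu1 k, hk⟩

/-- The probability that two sign patterns of the sample points, covering many points outside the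
low noise set, predict all the labels on the points which they cover: each of these predictions is
right with probability at most `1 - κ`, independently of the others. -/
theorem pi_setOf_exists_signPatterns_le {X : Type*} [MeasurableSpace X] (P : Measure (X × ℝ))
    [IsProbabilityMeasure P] {F : Set (X → ℝ)} (hFc : F.Countable) (hF : ∀ f ∈ F, Measurable f)
    {n G : ℕ} (hG : ∀ x : Fin n → X, (signPatterns F x).card ≤ G) (κ : ENNReal) (k : ℕ) :
    Measure.pi (fun _ : Fin n => P) {s | ∃ A ∈ signPatterns F fun i => (s i).1,
      ∃ B ∈ signPatterns F fun i => (s i).1,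
        k ≤ Nat.card {i : Fin n // i ∈ A ∪ B ∧ (s i).1 ∉ lowNoiseSet P κ} ∧
        (∀ i ∈ A, (s i).2 = 1) ∧ ∀ i ∈ B, (s i).2 = -1} ≤
      G ^ 2 * (1 - κ) ^ k := by
  classical
  set N : Set X := lowNoiseSet P κ with hN
  have hNm : MeasurableSet N := measurableSet_lowNoiseSet P κ
  -- On a point of both patterns any prescription will do: no label is both `1` and `-1`.
  set e : Finset (Fin n) × Finset (Fin n) → Fin n → Set ℝ := fun AB i =>
    if i ∈ AB.1 then {1} else if i ∈ AB.2 then {-1} else Set.univ with he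
  have hem : ∀ AB i, MeasurableSet (e AB i) := fun AB i => by
    simp only [he]
    split_ifs <;> simp
  set Q : Finset (Fin n) × Finset (Fin n) → Set (Fin n → X) := fun AB =>
    {x | AB.1 ∈ signPatterns F x} ∩ {x | AB.2 ∈ signPatterns F x} ∩
      {x | k ≤ Nat.card {i : Fin n // i ∈ AB.1 ∪ AB.2 ∧ x i ∉ N}} with hQ
  have hcard : ∀ (AB : Finset (Fin n) × Finset (Fin n)) (x : Fin n → X),
      Nat.card {i : Fin n // i ∈ AB.1 ∪ AB.2 ∧ x i ∉ N} =
        ∑ i ∈ AB.1 ∪ AB.2, Nᶜ.indicator (fun _ => 1) (x i) := by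
    intro AB x
    rw [Nat.card_eq_fintype_card, Fintype.card_subtype]
    simp only [Set.indicator_apply, Set.mem_compl_iff]
    rw [← Finset.card_filter]
    congr 1
    ext i
    simp
  have hQm : ∀ AB, MeasurableSet (Q AB) := fun AB => by
    refine ((measurableSet_mem_signPatterns hFc hF _).inter
      (measurableSet_mem_signPatterns hFc hF _)).inter ?_
    simp only [hcard]
    refine measurableSet_le measurable_const (Finset.measurable_sum _ fun i _ => ?_)
    exact (measurable_const.indicator hNm.compl).comp (measurable_pi_apply i)
  -- The labels prescribed on `A ∪ B` have small conditional probability.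
  have hprod : ∀ AB, ∀ x ∈ Q AB, ∏ i, P.condKernel (x i) (e AB i) ≤ (1 - κ) ^ k := by
    intro AB x hx
    set T : Finset (Fin n) := Finset.univ.filter fun i => i ∈ AB.1 ∪ AB.2 ∧ x i ∉ N with hT
    have hkT : k ≤ T.card := by
      have := hx.2
      rwa [Set.mem_ofPred_eq, Nat.card_eq_fintype_card, Fintype.card_subtype] at this
    calc ∏ i, P.condKernel (x i) (e AB i)
        ≤ ∏ i, if i ∈ T then 1 - κ else 1 := by
          refine Finset.prod_le_prod' fun i _ => ?_
          by_cases hi : i ∈ T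
          · rw [if_pos hi]
            obtain ⟨hiAB, hiN⟩ := (Finset.mem_filter.1 hi).2
            have hle := condKernel_le_of_notMem_lowNoiseSet hiN
            by_cases h1 : i ∈ AB.1
            · simpa [he, h1] using hle.1
            · have h2 : i ∈ AB.2 := (Finset.mem_union.1 hiAB).resolve_left h1
              simpa [he, h1, h2] using hle.2
          · rw [if_neg hi]
            exact prob_le_one
      _ = (1 - κ) ^ T.card := by
          rw [Finset.prod_ite_mem, Finset.univ_inter, Finset.prod_const]
      _ ≤ (1 - κ) ^ k := pow_le_pow_right_of_le_one' tsub_le_self hkT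
  calc Measure.pi (fun _ : Fin n => P) {s | ∃ A ∈ signPatterns F fun i => (s i).1,
      ∃ B ∈ signPatterns F fun i => (s i).1,
        k ≤ Nat.card {i : Fin n // i ∈ A ∪ B ∧ (s i).1 ∉ N} ∧
        (∀ i ∈ A, (s i).2 = 1) ∧ ∀ i ∈ B, (s i).2 = -1}
      ≤ Measure.pi (fun _ : Fin n => P) (⋃ AB ∈ (Finset.univ : Finset
          (Finset (Fin n) × Finset (Fin n))),
          {s | (fun i => (s i).1) ∈ Q AB ∧ ∀ i, (s i).2 ∈ e AB i}) := by
        refine measure_mono ?_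
        rintro s ⟨A, hA, B, hB, hk, h1, h2⟩
        refine Set.mem_biUnion (Finset.mem_coe.2 (Finset.mem_univ (A, B)))
          ⟨⟨⟨hA, hB⟩, hk⟩, fun i => ?_⟩
        simp only [he]
        split_ifs with hiA hiB
        · exact h1 i hiA
        · exact h2 i hiB
        · trivial
    _ ≤ ∑ AB, Measure.pi (fun _ : Fin n => P)
          {s | (fun i => (s i).1) ∈ Q AB ∧ ∀ i, (s i).2 ∈ e AB i} :=
        measure_biUnion_finset_le _ _
    _ ≤ ∑ AB, (1 - κ) ^ k * ∫⁻ x, (Q AB).indicator 1 x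
          ∂(Measure.pi fun _ : Fin n => P.fst) := by
        refine Finset.sum_le_sum fun AB _ => ?_
        rw [pi_setOf_labels_mem P (hem AB) (hQm AB), lintegral_indicator_one (hQm AB),
          ← setLIntegral_const]
        exact setLIntegral_mono measurable_const (hprod AB)
    _ = (1 - κ) ^ k * ∫⁻ x, ∑ AB, (Q AB).indicator 1 x
          ∂(Measure.pi fun _ : Fin n => P.fst) := by
        rw [lintegral_finsetSum _ fun AB _ => measurable_one.indicator (hQm AB), Finset.mul_sum]
    _ ≤ (1 - κ) ^ k * ∫⁻ x, (G : ENNReal) ^ 2 ∂(Measure.pi fun _ : Fin n => P.fst) := by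
        gcongr with x
        calc ∑ AB, (Q AB).indicator (1 : (Fin n → X) → ENNReal) x
            ≤ ∑ AB, if AB ∈ signPatterns F x ×ˢ signPatterns F x then (1 : ENNReal) else 0 := by
              refine Finset.sum_le_sum fun AB _ => ?_
              by_cases hx : x ∈ Q AB
              · rw [Set.indicator_of_mem hx, if_pos (Finset.mem_product.2 ⟨hx.1.1, hx.1.2⟩)]
                rfl
              · rw [Set.indicator_of_notMem hx]
                exact zero_le
          _ = ((signPatterns F x).card : ENNReal) ^ 2 := by
              rw [Finset.sum_ite_mem, Finset.univ_inter, Finset.sum_const, Finset.card_product]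
              simp [sq]
          _ ≤ (G : ENNReal) ^ 2 := by
              gcongr
              exact hG x
    _ = G ^ 2 * (1 - κ) ^ k := by
        rw [lintegral_const, measure_univ, mul_one, mul_comm]

/-- The empirical frequency of a set exceeds its probability by `δ` with exponentially small
probability (Hoeffding). -/
theorem pi_setOf_lt_card_le {X : Type*} [MeasurableSpace X] (μ : Measure X)
    [IsProbabilityMeasure μ] {D : Set X} (hD : MeasurableSet D) {δ : ℝ} (hδ : 0 < δ) (n : ℕ) :
    (Measure.pi fun _ : Fin n => μ).real
      {x | (μ.real D + δ) * n < Nat.card {i : Fin n // x i ∈ D}} ≤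
      Real.exp (-(2 * δ ^ 2 * n)) := by
  classical
  rcases Nat.eq_zero_or_pos n with rfl | hn
  · simp
  set Y : X → ℝ := fun a => D.indicator (fun _ => (1 : ℝ)) a with hY
  have hYm : Measurable Y := measurable_const.indicator hD
  have hint : ∫ a, Y a ∂μ = μ.real D := by
    rw [hY, integral_indicator hD]
    simp
  have hsub : HasSubgaussianMGF (fun a => Y a - μ.real D) ((‖(1 : ℝ) - 0‖₊ / 2) ^ 2) μ := by
    rw [← hint]
    refine hasSubgaussianMGF_of_mem_Icc hYm.aemeasurable (ae_of_all _ fun a => ?_)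
    by_cases ha : a ∈ D <;> simp [hY, ha]
  have hsub' : ∀ i ∈ (Finset.univ : Finset (Fin n)),
      HasSubgaussianMGF (fun x : Fin n → X => Y (x i) - μ.real D) ((‖(1 : ℝ) - 0‖₊ / 2) ^ 2)
        (Measure.pi fun _ : Fin n => μ) := fun i _ => by
    refine HasSubgaussianMGF.of_map (X := fun a => Y a - μ.real D)
      (Y := fun x : Fin n → X => x i) (measurable_pi_apply i).aemeasurable ?_
    rwa [(measurePreserving_eval (fun _ : Fin n => μ) i).map_eq]
  have h := HasSubgaussianMGF.measure_sum_ge_le_of_iIndepFun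
    (iIndepFun_pi (μ := fun _ : Fin n => μ)
      (X := fun (_ : Fin n) a => Y a - μ.real D) fun i => by fun_prop)
    hsub' (ε := δ * n) (by positivity)
  refine (measureReal_mono ?_).trans (h.trans (le_of_eq ?_))
  · intro x hx
    have hcard : (Nat.card {i : Fin n // x i ∈ D} : ℝ) = ∑ i, Y (x i) := by
      rw [Nat.card_eq_fintype_card, Fintype.card_subtype]
      simp [hY, Set.indicator_apply]
    simp only [Set.mem_ofPred_eq] at hx ⊢
    rw [hcard] at hx
    rw [Finset.sum_sub_distrib]
    simp only [Finset.sum_const, Finset.card_univ, Fintype.card_fin, nsmul_eq_mul]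
    linarith
  · congr 1
    have hn' : (n : ℝ) ≠ 0 := by positivity
    simp
    field_simp

/-! ### Overfitting forces a large norm -/

/-- If `f₁` and `f₂` are close to `h - t / 2` and `-h - t / 2`, then the positivity sets of `f₁`
and `f₂` cover the sample points with margin larger than `t`, while `h` is positive on the first
and negative on the second; zero classification loss determines the labels there. -/
theorem TOverfits.labels_of_approx {X : Type*} {t β : ℝ} (ht : 0 < t) {n : ℕ}
    {s : Fin n → X × ℝ} {h : X → ℝ} (hh : TOverfits t β s h)
    (hs : ∀ i, (s i).2 = 1 ∨ (s i).2 = -1) {f₁ f₂ : X → ℝ}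
    (h₁ : ∀ i, |h (s i).1 + -(t / 2) - f₁ (s i).1| ≤ t / 4)
    (h₂ : ∀ i, |-h (s i).1 + -(t / 2) - f₂ (s i).1| ≤ t / 4) {A B : Finset (Fin n)}
    (hA : ∀ i, i ∈ A ↔ 0 < f₁ (s i).1) (hB : ∀ i, i ∈ B ↔ 0 < f₂ (s i).1) :
    (∀ i ∈ A, (s i).2 = 1) ∧ (∀ i ∈ B, (s i).2 = -1) ∧ β * n ≤ (A ∪ B).card := by
  simp only [abs_le] at h₁ h₂
  refine ⟨fun i hi => (hs i).resolve_right fun hy => ?_,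
    fun i hi => (hs i).resolve_left fun hy => ?_, hh.margin.trans ?_⟩
  · have h3 := hh.zero_loss i
    rw [hy] at h3
    linarith [(h₁ i).1, (hA i).1 hi]
  · have h3 := hh.zero_loss i
    rw [hy] at h3
    linarith [(h₂ i).1, (hB i).1 hi]
  · classical
    rw [Nat.card_eq_fintype_card, Fintype.card_subtype]
    refine Nat.cast_le.2 (Finset.card_le_card fun i hi => ?_)
    have hm := (Finset.mem_filter.1 hi).2
    rw [Finset.mem_union, hA, hB]
    rcases hs i with hy | hy <;> rw [hy] at hm
    · left; linarith [(h₁ i).2]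
    · right; linarith [(h₂ i).2]

theorem le_card_union_notMem {X : Type*} {n k : ℕ} {x : Fin n → X} {D : Set X}
    {A B : Finset (Fin n)} {u v : ℝ} (hAB : u ≤ (A ∪ B).card)
    (hD : (Nat.card {i : Fin n // x i ∈ D} : ℝ) ≤ v) (hk : (k : ℝ) ≤ u - v) :
    k ≤ Nat.card {i : Fin n // i ∈ A ∪ B ∧ x i ∉ D} := by
  classical
  rw [Nat.card_eq_fintype_card, Fintype.card_subtype] at hD ⊢
  have h1 : (A ∪ B).card ≤ (Finset.univ.filter fun i => i ∈ A ∪ B ∧ x i ∉ D).card +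
      (Finset.univ.filter fun i => x i ∈ D).card := by
    refine (Finset.card_le_card fun i hi => ?_).trans (Finset.card_union_le _ _)
    by_cases hx : x i ∈ D
    · exact Finset.mem_union_right _ (by simpa using hx)
    · exact Finset.mem_union_left _ (by simpa [hx] using Finset.mem_union.1 hi)
  have h2 : ((A ∪ B).card : ℝ) ≤ ((Finset.univ.filter fun i => i ∈ A ∪ B ∧ x i ∉ D).card : ℝ) +
      (Finset.univ.filter fun i => x i ∈ D).card := by exact_mod_cast h1
  have h3 : (k : ℝ) ≤ (Finset.univ.filter fun i => i ∈ A ∪ B ∧ x i ∉ D).card := by linarith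
  exact_mod_cast h3

/-- The rational combinations of the approximating functions. -/
noncomputable def approxClass (d : ℕ) (σ : ℝ) (m : ℕ) : Set (EuclideanSpace ℝ (Fin d) → ℝ) :=
  Set.range fun (c : Option (Fin d → Fin m) → ℚ) x => ∑ o, (c o : ℝ) * approxBasis d σ m o x

theorem approxClass_subset_span (d : ℕ) (σ : ℝ) (m : ℕ) :
    approxClass d σ m ⊆ Submodule.span ℝ (Set.range (approxBasis d σ m)) := by
  rintro _ ⟨c, rfl⟩
  refine (Submodule.mem_span_range_iff_exists_fun ℝ).2 ⟨fun o => c o, ?_⟩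
  funext x
  simp

theorem measurable_of_mem_approxClass {d : ℕ} {σ : ℝ} {m : ℕ}
    {f : EuclideanSpace ℝ (Fin d) → ℝ} (hf : f ∈ approxClass d σ m) : Measurable f := by
  obtain ⟨c, rfl⟩ := hf
  exact (continuous_finsetSum _ fun o _ =>
    continuous_const.mul (continuous_approxBasis d σ m o)).measurable

/-- The probability of two rare events bounds that of a sample being `t`-overfitted by some `h` of
norm at most `R`, where `R` is so small compared with `e ^ m` that `h` is close to the span of
`m ^ d + 1` fixed functions: an atypical number of points of low noise, and correct prediction of
many noisy labels by one of few sign patterns. -/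
theorem pi_setOf_exists_tOverfits_le {d : ℕ} {σ : ℝ} {Ω : Set (EuclideanSpace ℝ (Fin d))}
    {L : ℝ} (hL : Ω ⊆ Metric.closedBall 0 L)
    {P : Measure (EuclideanSpace ℝ (Fin d) × ℝ)} [IsProbabilityMeasure P]
    (hP : ∀ᵐ p ∂P, p.1 ∈ Ω ∧ (p.2 = 1 ∨ p.2 = -1)) {t β : ℝ} (ht : 0 < t) {n m G k : ℕ}
    (hG : ∀ x : Fin n → EuclideanSpace ℝ (Fin d),
      (signPatterns (approxClass d σ m) x).card ≤ G)
    {R : ℝ} (hR : 2 * Real.exp (L ^ 2 / σ ^ 2 * Real.exp 2 / 2) * Real.exp (-m) * R ≤ t / 8)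
    {κ : ENNReal} {δ : ℝ} (hδ : 0 < δ)
    (hk : (k : ℝ) ≤ β * n - (P.fst.real (lowNoiseSet P κ) + δ) * n) :
    Measure.pi (fun _ : Fin n => P)
      {s | ∃ h : GaussianRKHS d σ, TOverfits t β s h ∧ ‖h‖ ≤ R} ≤
      ENNReal.ofReal (Real.exp (-(2 * δ ^ 2 * n))) + G ^ 2 * (1 - κ) ^ k := by
  set N := lowNoiseSet P κ with hN
  set E₁ : Set (Fin n → EuclideanSpace ℝ (Fin d) × ℝ) := (fun s i => (s i).1) ⁻¹'
    {x | (P.fst.real N + δ) * n < Nat.card {i : Fin n // x i ∈ N}} with hE₁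
  have hE₁le : Measure.pi (fun _ : Fin n => P) E₁ ≤
      ENNReal.ofReal (Real.exp (-(2 * δ ^ 2 * n))) := by
    have hmap : (Measure.pi fun _ : Fin n => P).map (fun s i => (s i).1) =
        Measure.pi fun _ : Fin n => P.fst :=
      Measure.pi_map_pi fun i => measurable_fst.aemeasurable
    have hproj : Measurable fun (s : Fin n → EuclideanSpace ℝ (Fin d) × ℝ) i => (s i).1 := by
      fun_prop
    refine (Measure.le_map_apply hproj.aemeasurable _).trans ?_
    rw [hmap, ← ofReal_measureReal]
    exact ENNReal.ofReal_le_ofReal (pi_setOf_lt_card_le P.fst (measurableSet_lowNoiseSet P κ) hδ n)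
  have hE₂le := pi_setOf_exists_signPatterns_le P
    (F := approxClass d σ m) (Set.countable_range _)
    (fun f hf => measurable_of_mem_approxClass hf) hG κ k
  have hae : ∀ᵐ s ∂(Measure.pi fun _ : Fin n => P),
      ∀ i, (s i).1 ∈ Ω ∧ ((s i).2 = 1 ∨ (s i).2 = -1) :=
    ae_all_iff.2 fun i =>
      (measurePreserving_eval (fun _ : Fin n => P) i).quasiMeasurePreserving.ae hP
  refine le_trans (measure_mono_ae ?_) ((measure_union_le _ _).trans (add_le_add hE₁le hE₂le))
  filter_upwards [hae] with s hs
  rintro ⟨h, hh, hhR⟩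
  by_cases hsE : s ∈ E₁
  · exact Or.inl hsE
  refine Or.inr ?_
  have hsE' : (Nat.card {i : Fin n // (s i).1 ∈ N} : ℝ) ≤ (P.fst.real N + δ) * n := not_lt.1 hsE
  have herr : 2 * Real.exp (L ^ 2 / σ ^ 2 * Real.exp 2 / 2) * Real.exp (-m) * ‖h‖ + t / 8 ≤
      t / 4 := by
    have : 2 * Real.exp (L ^ 2 / σ ^ 2 * Real.exp 2 / 2) * Real.exp (-m) * ‖h‖ ≤
        2 * Real.exp (L ^ 2 / σ ^ 2 * Real.exp 2 / 2) * Real.exp (-m) * R := by gcongr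
    linarith
  obtain ⟨c₁, hc₁⟩ := gaussianRKHS_exists_rat_approx (L := L) h (-(t / 2)) m
    (show 0 < t / 8 by positivity)
  obtain ⟨c₂, hc₂⟩ := gaussianRKHS_exists_rat_approx (L := L) (-h) (-(t / 2)) m
    (show 0 < t / 8 by positivity)
  classical
  set f₁ : EuclideanSpace ℝ (Fin d) → ℝ := fun x => ∑ o, (c₁ o : ℝ) * approxBasis d σ m o x
  set f₂ : EuclideanSpace ℝ (Fin d) → ℝ := fun x => ∑ o, (c₂ o : ℝ) * approxBasis d σ m o x
  set A : Finset (Fin n) := Finset.univ.filter fun i => 0 < f₁ (s i).1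
  set B : Finset (Fin n) := Finset.univ.filter fun i => 0 < f₂ (s i).1
  have hA : ∀ i, i ∈ A ↔ 0 < f₁ (s i).1 := fun i => by simp [A]
  have hB : ∀ i, i ∈ B ↔ 0 < f₂ (s i).1 := fun i => by simp [B]
  have h₁ : ∀ i, |h (s i).1 + -(t / 2) - f₁ (s i).1| ≤ t / 4 := fun i =>
    (hc₁ _ (hL (hs i).1)).trans herr
  have h₂ : ∀ i, |-h (s i).1 + -(t / 2) - f₂ (s i).1| ≤ t / 4 := fun i => by
    have h3 := hc₂ _ (hL (hs i).1)
    rw [RKHS.coe_neg, Pi.neg_apply, norm_neg] at h3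
    exact h3.trans herr
  obtain ⟨hA1, hB1, hcard⟩ := hh.labels_of_approx ht (fun i => (hs i).2) h₁ h₂ hA hB
  exact ⟨A, mem_signPatterns.2 ⟨f₁, ⟨c₁, rfl⟩, hA⟩, B, mem_signPatterns.2 ⟨f₂, ⟨c₂, rfl⟩, hB⟩,
    le_card_union_notMem hcard hsE' hk, hA1, hB1⟩

/-- A number of patterns growing like `exp (κ δ n / 2)` cannot compensate the probability
`(1 - κ) ^ (2 δ n)` that a single pair of patterns is right. -/
theorem sq_mul_one_sub_pow_le {κ δ l ℓ c : ℝ} {n D k G : ℕ} (hκ : 0 < κ) (hκ1 : κ < 1)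
    (hl : 0 < l) (hl4 : l = κ * δ / 4) (hℓ : ℓ = Real.log l⁻¹) (hℓ0 : 0 < ℓ)
    (hc : c * ℓ = κ * δ / 4)
    (hG : (G : ℝ) ≤ (1 + l) ^ n * l⁻¹ ^ D) (hD : (D : ℝ) ≤ c * n) (hk : 2 * δ * n - 1 ≤ k) :
    (G : ENNReal) ^ 2 * (1 - ENNReal.ofReal κ) ^ k ≤
      ENNReal.ofReal (Real.exp (κ - κ * δ * n)) := by
  have h1 : (1 + l) ^ n ≤ Real.exp (l * n) := by
    rw [mul_comm, Real.exp_nat_mul]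
    have := Real.add_one_le_exp l
    exact pow_le_pow_left₀ (by positivity) (by linarith) n
  have h2 : l⁻¹ ^ D ≤ Real.exp (c * ℓ * n) := by
    rw [← Real.exp_log (inv_pos.2 hl), ← Real.exp_nat_mul, ← hℓ]
    refine Real.exp_le_exp.2 ?_
    nlinarith
  have h3 : (G : ℝ) ≤ Real.exp (κ * δ / 2 * n) := by
    refine hG.trans ((mul_le_mul h1 h2 (by positivity) (by positivity)).trans (le_of_eq ?_))
    rw [← Real.exp_add, hl4, hc]
    ring_nf
  have h4 : (1 - κ) ^ k ≤ Real.exp (-κ * (2 * δ * n - 1)) := by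
    have h5 := Real.add_one_le_exp (-κ)
    calc (1 - κ) ^ k ≤ Real.exp (-κ) ^ k := pow_le_pow_left₀ (by linarith) (by linarith) k
      _ = Real.exp (-κ * k) := by rw [← Real.exp_nat_mul, mul_comm]
      _ ≤ _ := Real.exp_le_exp.2 (by nlinarith)
  have h6 : (G : ENNReal) ^ 2 * (1 - ENNReal.ofReal κ) ^ k =
      ENNReal.ofReal ((G : ℝ) ^ 2 * (1 - κ) ^ k) := by
    rw [ENNReal.ofReal_mul (by positivity), ENNReal.ofReal_pow (by positivity),
      ENNReal.ofReal_pow (by linarith), ENNReal.ofReal_natCast, ENNReal.ofReal_sub _ hκ.le,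
      ENNReal.ofReal_one]
  rw [h6]
  refine ENNReal.ofReal_le_ofReal ?_
  calc (G : ℝ) ^ 2 * (1 - κ) ^ k
      ≤ Real.exp (κ * δ / 2 * n) ^ 2 * Real.exp (-κ * (2 * δ * n - 1)) := by
        gcongr
    _ = Real.exp (κ - κ * δ * n) := by
        rw [← Real.exp_nat_mul, ← Real.exp_add]
        ring_nf

theorem theorem1 (d : ℕ) (hd : 1 ≤ d) (σ : ℝ) (hσ : 0 < σ)
    (Ω : Set (EuclideanSpace ℝ (Fin d))) (hΩ : Bornology.IsBounded Ω)
    (P : Measure (EuclideanSpace ℝ (Fin d) × ℝ)) [IsProbabilityMeasure P]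
    (hP : ∀ᵐ p ∂P, p.1 ∈ Ω ∧ (p.2 = 1 ∨ p.2 = -1))
    (hnoise : 0 < classBayesRisk P)
    (β : ℝ) (hβ : β ≤ 1)
    (hdet : ∀ S : Set (EuclideanSpace ℝ (Fin d)), MeasurableSet S → DeterministicOn P S →
      P.fst.real S < β)
    (t : ℝ) (ht : 0 < t) :
    ∃ A B : ℝ, 0 < A ∧ 0 < B ∧
      Tendsto (fun n : ℕ => Measure.pi (fun _ : Fin n => P)
        {s | ¬ ∀ h : GaussianRKHS d σ, TOverfits t β s h →
          A * Real.exp (B * (n : ℝ) ^ (1 / (d : ℝ))) < ‖h‖}) atTop (𝓝 0) := by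
  obtain ⟨L, hL⟩ := hΩ.subset_closedBall (0 : EuclideanSpace ℝ (Fin d))
  obtain ⟨κ, hκ, hκ1, hq⟩ := exists_lowNoiseSet_lt (hP.mono fun p hp => hp.2) hdet
  set q : ℝ := P.fst.real (lowNoiseSet P (ENNReal.ofReal κ)) with hq'
  have hq0 : 0 ≤ q := measureReal_nonneg
  -- A slack of `3 δ` is shared between the law of large numbers and the noisy sample points.
  set δ : ℝ := (β - q) / 3 with hδ'
  have hδ : 0 < δ := by rw [hδ']; linarith
  have hδ1 : δ < 1 := by rw [hδ']; linarith
  set l : ℝ := κ * δ / 4 with hl'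
  have hl : 0 < l := by positivity
  have hl1 : l < 1 := by rw [hl']; nlinarith
  set ℓ : ℝ := Real.log l⁻¹ with hℓ'
  have hℓ : 0 < ℓ := Real.log_pos (one_lt_inv_iff₀.2 ⟨hl, hl1⟩)
  set c : ℝ := κ * δ / 4 / ℓ with hc'
  have hc : 0 < c := by positivity
  set K : ℝ := Real.exp (L ^ 2 / σ ^ 2 * Real.exp 2 / 2) with hK'
  have hK : 0 < K := Real.exp_pos _
  set A : ℝ := t / (16 * K * Real.exp 1) with hA'
  set B : ℝ := (c / 2) ^ (1 / (d : ℝ)) with hB'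
  refine ⟨A, B, by positivity, by positivity, ?_⟩
  have hlim : Tendsto (fun n : ℕ => ENNReal.ofReal (Real.exp (-(2 * δ ^ 2 * n))) +
      ENNReal.ofReal (Real.exp (κ - κ * δ * n))) atTop (𝓝 0) := by
    have h1 : Tendsto (fun n : ℕ => Real.exp (-(2 * δ ^ 2 * n))) atTop (𝓝 0) :=
      Real.tendsto_exp_neg_atTop_nhds_zero.comp
        (tendsto_natCast_atTop_atTop.const_mul_atTop (by positivity))
    have h2 : Tendsto (fun n : ℕ => Real.exp (κ - κ * δ * n)) atTop (𝓝 0) := by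
      refine Real.tendsto_exp_atBot.comp ?_
      simp only [sub_eq_add_neg]
      exact tendsto_atBot_add_const_left _ _ (tendsto_neg_atTop_atBot.comp
        (tendsto_natCast_atTop_atTop.const_mul_atTop (by positivity)))
    simpa using (ENNReal.tendsto_ofReal h1).add (ENNReal.tendsto_ofReal h2)
  refine tendsto_of_tendsto_of_tendsto_of_le_of_le' tendsto_const_nhds hlim
    (Eventually.of_forall fun _ => zero_le) ?_
  filter_upwards [(tendsto_natCast_atTop_atTop (R := ℝ)).eventually_ge_atTop (2 / c)] with n hn
  have hcn : 1 ≤ c / 2 * n := by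
    rw [div_le_iff₀ hc] at hn
    linarith
  set m : ℕ := ⌊(c / 2 * n) ^ (1 / (d : ℝ))⌋₊ with hm'
  have hroot : (c / 2 * n : ℝ) ^ (1 / (d : ℝ)) = B * (n : ℝ) ^ (1 / (d : ℝ)) :=
    Real.mul_rpow (by positivity) (by positivity)
  -- The approximation space has dimension at most `c n`.
  have hD : ((Fintype.card (Option (Fin d → Fin m)) : ℕ) : ℝ) ≤ c * n := by
    have h1 : (m : ℝ) ^ d ≤ c / 2 * n := by
      calc (m : ℝ) ^ d ≤ ((c / 2 * n : ℝ) ^ (1 / (d : ℝ))) ^ d := by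
            gcongr
            exact Nat.floor_le (by positivity)
        _ = c / 2 * n := by
            rw [one_div, Real.rpow_inv_natCast_pow (by positivity) (by omega)]
    simp only [Fintype.card_option, Fintype.card_fun, Fintype.card_fin]
    push_cast
    linarith
  have hR : 2 * K * Real.exp (-m) * (A * Real.exp (B * (n : ℝ) ^ (1 / (d : ℝ)))) ≤ t / 8 := by
    have h1 : B * (n : ℝ) ^ (1 / (d : ℝ)) ≤ m + 1 := by
      rw [← hroot]
      exact (Nat.lt_floor_add_one _).le
    calc 2 * K * Real.exp (-m) * (A * Real.exp (B * (n : ℝ) ^ (1 / (d : ℝ))))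
        ≤ 2 * K * Real.exp (-m) * (A * Real.exp (m + 1)) := by gcongr
      _ = 2 * K * A * (Real.exp (-m) * Real.exp (m + 1)) := by ring
      _ = 2 * K * A * Real.exp 1 := by rw [← Real.exp_add]; ring_nf
      _ = t / 8 := by
          rw [hA']
          field_simp
          norm_num
  set G : ℕ := ⌊(1 + l) ^ n * l⁻¹ ^ Fintype.card (Option (Fin d → Fin m))⌋₊ with hG'
  have hG : ∀ x : Fin n → EuclideanSpace ℝ (Fin d),
      (signPatterns (approxClass d σ m) x).card ≤ G := fun x =>
    Nat.le_floor (card_signPatterns_le (approxClass_subset_span d σ m) x hl hl1.le)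
  set k : ℕ := ⌊2 * δ * n⌋₊ with hk'
  have hk : (k : ℝ) ≤ β * n - (q + δ) * n := by
    have h1 : (k : ℝ) ≤ 2 * δ * n := Nat.floor_le (by positivity)
    have h2 : β = q + 3 * δ := by rw [hδ']; ring
    rw [h2]
    linarith
  have hbound := pi_setOf_exists_tOverfits_le hL hP ht hG hR hδ hk
  refine (measure_mono ?_).trans (hbound.trans (add_le_add le_rfl
    (sq_mul_one_sub_pow_le hκ hκ1 hl hl' hℓ' hℓ (by rw [hc']; field_simp)
      (Nat.floor_le (by positivity)) hD (Nat.sub_one_lt_floor _).le)))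
  intro s hs
  simp only [Set.mem_ofPred_eq, not_forall, not_lt] at hs
  obtain ⟨h, hh, hle⟩ := hs
  exact ⟨h, hh, hle⟩
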